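/- Let $\mathcal M$ be a deterministic Turing machine with one tape (two-way infinite, initially containing the input word and otherwise blank, with the head on the first input letter), finite tape alphabet and finitely many states, which in one step rewrites the scanned cell, changes state and moves its head by at most one cell. Let $A$ be its input alphabet, with $|A|\ge 2$, and suppose that $\mathcal M$ recognizes palindromes, i.e. a word $w\in A^*$ is accepted by $\mathcal M$ (the computation on $w$ halts in an accepting state) if and only if $w$ is a palindrome. Then the running time of $\mathcal M$ is $\Omega(n^2)$ on some inputs of each large length $n$: there are a constant $c>0$ and an integer $N$, depending only on $\mathcal M$, such that for every $n\ge N$ there is a palindrome $w\in A^*$ of length $n$ on which $\mathcal M$ makes at least $c\,n^2$ steps before it halts. -/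

import Mathlib

/-- The possible head movements of a Turing machine in one step. -/
inductive HeadMove where
  | left
  | stay
  | right

/-- The displacement of the head on the tape `ℤ`. -/
def HeadMove.toInt : HeadMove → ℤ
  | .left => -1
  | .stay => 0
  | .right => 1

/-- A deterministic Turing machine with a single two-way infinite tape, input alphabet `α`, tape
alphabet `Γ` and set of states `Q`. In state `q`, reading the symbol `a`, the machine halts if
`δ q a = none`; if `δ q a = some (q', b, d)`, it writes `b`, moves its head according to `d` and
enters state `q'`, all in one step. Finiteness of `Γ` and `Q` is required where machines are
quantified over. -/
structure OneTapeTM (α Γ Q : Type*) where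
  /-- the initial state -/
  start : Q
  /-- the accepting states -/
  accept : Set Q
  /-- the blank symbol -/
  blank : Γ
  /-- the input letters, as tape symbols -/
  input : α ↪ Γ
  /-- the blank symbol is not an input letter -/
  input_ne_blank : ∀ a, input a ≠ blank
  /-- the transition function -/
  δ : Q → Γ → Option (Q × Γ × HeadMove)

namespace OneTapeTM

/-- A configuration: the state, the position of the head and the contents of the tape. -/
structure Cfg (Γ Q : Type*) where
  state : Q
  head : ℤ
  tape : ℤ → Γ

/-- The initial tape: the input stands on the cells `0, …, w.length - 1`; all other cells are
blank. -/
def initTape {α Γ Q : Type*} (M : OneTapeTM α Γ Q) (w : List α) : ℤ → Γ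
  | Int.ofNat k => (w[k]?).elim M.blank M.input
  | Int.negSucc _ => M.blank

/-- The initial configuration: initial state, head on the first input cell. -/
def init {α Γ Q : Type*} (M : OneTapeTM α Γ Q) (w : List α) : Cfg Γ Q :=
  ⟨M.start, 0, M.initTape w⟩

/-- One step of the computation; `none` if the machine halts in the given configuration. -/
def step {α Γ Q : Type*} (M : OneTapeTM α Γ Q) (c : Cfg Γ Q) : Option (Cfg Γ Q) :=
  (M.δ c.state (c.tape c.head)).map fun r =>
    ⟨r.1, c.head + r.2.2.toInt, Function.update c.tape c.head r.2.1⟩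

/-- The configuration reached on input `w` after exactly `t` steps; `none` if the machine halts
after fewer than `t` steps. -/
def run {α Γ Q : Type*} (M : OneTapeTM α Γ Q) (w : List α) : ℕ → Option (Cfg Γ Q)
  | 0 => some (M.init w)
  | t + 1 => (M.run w t).bind M.step

/-- On input `w` the machine halts after exactly `t` steps, in an accepting state. -/
def AcceptsIn {α Γ Q : Type*} (M : OneTapeTM α Γ Q) (w : List α) (t : ℕ) : Prop :=
  ∃ c, M.run w t = some c ∧ M.step c = none ∧ c.state ∈ M.accept

/-- The machine recognizes the language `L`: it accepts exactly the words in `L`. (On other words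
it may reject or run forever.) -/
def Recognizes {α Γ Q : Type*} (M : OneTapeTM α Γ Q) (L : Language α) : Prop :=
  ∀ w : List α, w ∈ L ↔ ∃ t, M.AcceptsIn w t

end OneTapeTM

/-- The language of palindromes over the alphabet `α`. -/
def palindromes (α : Type*) : Language α :=
  {w : List α | w.Palindrome}

/-! ### Crossing sequences and merged configurations. -/

namespace OneTapeTM

variable {α Γ Q : Type*}

/-! At each cell boundary, record the states in which the head crosses it. If the accepting
computations on `u ++ v` and `u' ++ v'`, with `u`, `u'` nonempty of equal length, have the same
sequence at the boundary after `u`, then the left half of the first and the right half of the second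
glue to an accepting computation on `u ++ v'` (`exists_run_merge`, `exists_acceptsIn_of_trace`). For
palindromes made of `x`, a padding and the reverse of `x`, distinct `x` of equal length must
therefore have distinct sequences at each boundary of the padding (`eq_of_trace_paddedPalindrome`).

There are too few short sequences for all `2 ^ k` binary words `x`, so for some `x` every padding
boundary has a sequence of length at least of order `n`. A step crosses at most one boundary, and
there are of order `n` of them, so the time is at least of order `n ^ 2`. -/

/-- `M.Trace i w l c`: on input `w` the machine `M` reaches the configuration `c`, and `l` lists, most
recent first, the states it enters whenever its head crosses the boundary between the cells
`i - 1` and `i`. -/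
inductive Trace (M : OneTapeTM α Γ Q) (i : ℤ) (w : List α) : List Q → Cfg Γ Q → Prop
  | init : Trace M i w [] (M.init w)
  | stay {l c c'} : Trace M i w l c → M.step c = some c' → (c.head < i ↔ c'.head < i) →
      Trace M i w l c'
  | cross {l c c'} : Trace M i w l c → M.step c = some c' → ¬(c.head < i ↔ c'.head < i) →
      Trace M i w (c'.state :: l) c'

/-- The configuration whose tape is that of `c` to the left of the boundary `i` and that of `d` to
the right, the state and the head being those of `c` or of `d` according to the side on which the
head of `c` stands. -/
def Cfg.merge (i : ℤ) (c d : Cfg Γ Q) : Cfg Γ Q where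
  state := if c.head < i then c.state else d.state
  head := if c.head < i then c.head else d.head
  tape z := if z < i then c.tape z else d.tape z

/-- The head starts on the left and each crossing switches sides, so equal crossing sequences put
two heads on the same side. -/
theorem Trace.head_lt_iff {M : OneTapeTM α Γ Q} {i : ℤ} {w : List α} {l : List Q} {c : Cfg Γ Q}
    (hi : 0 < i) (h : M.Trace i w l c) : c.head < i ↔ Even l.length := by
  induction h with
  | init => simpa [OneTapeTM.init] using hi
  | stay _ _ hs ih => rw [← hs, ih]
  | cross _ _ hs ih =>
    rw [List.length_cons, Nat.even_add_one, ← ih]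
    tauto

theorem step_eq_some_iff {M : OneTapeTM α Γ Q} {c c' : Cfg Γ Q} :
    M.step c = some c' ↔ ∃ r, M.δ c.state (c.tape c.head) = some r ∧
      ⟨r.1, c.head + r.2.2.toInt, Function.update c.tape c.head r.2.1⟩ = c' := by
  simp [step]

theorem tape_of_step {M : OneTapeTM α Γ Q} {c c' : Cfg Γ Q} (h : M.step c = some c') {z : ℤ}
    (hz : z ≠ c.head) : c'.tape z = c.tape z := by
  obtain ⟨r, -, rfl⟩ := step_eq_some_iff.1 h
  exact Function.update_of_ne hz _ _

theorem head_bounds_of_step {M : OneTapeTM α Γ Q} {c c' : Cfg Γ Q} (h : M.step c = some c') :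
    c.head - 1 ≤ c'.head ∧ c'.head ≤ c.head + 1 := by
  obtain ⟨r, -, rfl⟩ := step_eq_some_iff.1 h
  rcases r with ⟨q, b, _ | _ | _⟩ <;> (simp [HeadMove.toInt]; try omega)

/-- A step depends only on the state, the head position and the scanned symbol. -/
theorem step_of_agree {M : OneTapeTM α Γ Q} {c c' e e' : Cfg Γ Q} (h : M.step c = some c')
    (hs : e.state = c.state) (hh : e.head = c.head) (ht : e.tape c.head = c.tape c.head)
    (hs' : e'.state = c'.state) (hh' : e'.head = c'.head)
    (ht' : e'.tape c.head = c'.tape c.head)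
    (hr : ∀ z, z ≠ c.head → e'.tape z = e.tape z) : M.step e = some e' := by
  obtain ⟨r, hr', rfl⟩ := step_eq_some_iff.1 h
  refine step_eq_some_iff.2 ⟨r, by rw [hs, hh, ht, hr'], ?_⟩
  rcases e' with ⟨s', p', T'⟩
  dsimp only at hs' hh' ht' hr
  subst hs' hh'
  congr 1
  · rw [hh]
  · funext z
    by_cases hz : z = c.head
    · subst hz; rw [ht', hh]; simp
    · rw [hh, Function.update_of_ne hz, hr z hz]

/-- Steps of the right component taken on the left of the boundary are invisible after merging. -/
theorem merge_right_of_step {M : OneTapeTM α Γ Q} {i : ℤ} {c d d' : Cfg Γ Q}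
    (h : M.step d = some d') (hc : c.head < i) (hd : d.head < i) :
    c.merge i d' = c.merge i d := by
  simp only [Cfg.merge, hc, if_true, Cfg.mk.injEq, true_and]
  funext z
  split_ifs with hz
  · rfl
  · exact tape_of_step h (by omega)

theorem merge_left_of_step {M : OneTapeTM α Γ Q} {i : ℤ} {c c' d : Cfg Γ Q}
    (h : M.step c = some c') (hc : ¬c.head < i) (hc' : ¬c'.head < i) :
    c'.merge i d = c.merge i d := by
  simp only [Cfg.merge, hc, hc', if_false, Cfg.mk.injEq, true_and]
  funext z
  split_ifs with hz
  · exact tape_of_step h (by omega)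
  · rfl

/-- The merged configuration follows its left component as long as the head is on the left, also
into the step that crosses the boundary. -/
theorem step_merge_left {M : OneTapeTM α Γ Q} {i : ℤ} {c c' d d' : Cfg Γ Q}
    (h : M.step c = some c') (hc : c.head < i)
    (hs : (c'.merge i d').state = c'.state) (hh : (c'.merge i d').head = c'.head)
    (ht : ∀ z, ¬z < i → d'.tape z = d.tape z) :
    M.step (c.merge i d) = some (c'.merge i d') := by
  refine step_of_agree h ?_ ?_ ?_ hs hh ?_ ?_
  · simp [Cfg.merge, hc]
  · simp [Cfg.merge, hc]
  · simp [Cfg.merge, hc]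
  · simp [Cfg.merge, hc]
  · intro z hz
    simp only [Cfg.merge]
    split_ifs with hzi
    · exact tape_of_step h hz
    · exact ht z hzi

theorem step_merge_right {M : OneTapeTM α Γ Q} {i : ℤ} {c c' d d' : Cfg Γ Q}
    (h : M.step d = some d') (hc : ¬c.head < i) (hd : ¬d.head < i)
    (hs : (c'.merge i d').state = d'.state) (hh : (c'.merge i d').head = d'.head)
    (ht : ∀ z, z < i → c'.tape z = c.tape z) :
    M.step (c.merge i d) = some (c'.merge i d') := by
  refine step_of_agree h ?_ ?_ ?_ hs hh ?_ ?_
  · simp [Cfg.merge, hc]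
  · simp [Cfg.merge, hc]
  · simp [Cfg.merge, hd]
  · simp [Cfg.merge, hd]
  · intro z hz
    simp only [Cfg.merge]
    split_ifs with hzi
    · exact ht z hzi
    · exact tape_of_step h hz

/-! ### Gluing two computations. -/

theorem exists_run_of_step {M : OneTapeTM α Γ Q} {w : List α} {c c' : Cfg Γ Q}
    (h : ∃ t, M.run w t = some c) (hs : M.step c = some c') : ∃ t, M.run w t = some c' := by
  obtain ⟨t, ht⟩ := h
  exact ⟨t + 1, by simp [run, ht, hs]⟩

theorem merge_init (M : OneTapeTM α Γ Q) {u u' v v' : List α} (hlen : u.length = u'.length)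
    (hu : u ≠ []) :
    (M.init (u ++ v)).merge u.length (M.init (u' ++ v')) = M.init (u ++ v') := by
  have hpos : (0 : ℤ) < u.length := by exact_mod_cast List.length_pos_iff.2 hu
  simp only [Cfg.merge, OneTapeTM.init, hpos, if_true, Cfg.mk.injEq, true_and]
  funext z
  rcases z with k | k
  · simp only [initTape, Int.ofNat_eq_natCast, Nat.cast_lt]
    split_ifs with hk
    · rw [List.getElem?_append_left hk, List.getElem?_append_left hk]
    · rw [List.getElem?_append_right (by omega), List.getElem?_append_right (by omega), hlen]
  · simp [initTape]

/-- The cut-and-paste lemma: two computations with the same crossing sequence at a boundary can be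
merged into a computation on the word spliced at this boundary. -/
theorem exists_run_merge {M : OneTapeTM α Γ Q} {u u' v v' : List α}
    (hlen : u.length = u'.length) (hu : u ≠ []) {l : List Q} {c d : Cfg Γ Q}
    (hc : M.Trace u.length (u ++ v) l c) (hd : M.Trace u.length (u' ++ v') l d) :
    ∃ t, M.run (u ++ v') t = some (c.merge u.length d) := by
  have hpos : (0 : ℤ) < u.length := by exact_mod_cast List.length_pos_iff.2 hu
  generalize hw' : u' ++ v' = w' at hd
  induction hc generalizing d with
  | init =>
    generalize hl : ([] : List Q) = l at hd
    induction hd with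
    | init => exact ⟨0, by rw [← hw', merge_init M hlen hu, run]⟩
    | stay hd₀ hs _ ih =>
      subst hl
      rw [merge_right_of_step hs (by simpa [OneTapeTM.init] using hpos)
        ((hd₀.head_lt_iff hpos).2 (by simp))]
      exact ih rfl
    | cross => simp at hl
  | @stay l c c' hc₀ hs hside ih =>
    by_cases hlt : c.head < u.length
    · have hlt' := hside.1 hlt
      exact exists_run_of_step (ih hd) (step_merge_left hs hlt (by simp [Cfg.merge, hlt'])
        (by simp [Cfg.merge, hlt']) fun _ _ => rfl)
    · rw [merge_left_of_step hs hlt (mt hside.2 hlt)]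
      exact ih hd
  | @cross l c c' hc₀ hs hside ih =>
    have hc' := (hc₀.cross hs hside).head_lt_iff hpos
    -- The inner induction peels off the steps that the second computation makes after its last
    -- crossing, until it meets the crossing that matches the one of the first.
    generalize hl : c'.state :: l = l' at hd hc'
    induction hd with
    | init => simp at hl
    | @stay l'' d d' hd₀ hsd hsided ihd =>
      have hdd := hd₀.head_lt_iff hpos
      by_cases hlt : c'.head < u.length
      · rw [merge_right_of_step hsd hlt (hdd.2 (hc'.1 hlt))]
        exact ihd hl hc'
      · exact exists_run_of_step (ihd hl hc') (step_merge_right hsd hlt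
          (fun h => hlt (hc'.2 (hdd.1 h))) (by simp [Cfg.merge, hlt]) (by simp [Cfg.merge, hlt])
          fun _ _ => rfl)
    | @cross l'' d d' hd₀ hsd hsided ihd =>
      obtain ⟨hq, rfl⟩ := List.cons.inj hl
      have hcd : c.head < u.length ↔ d.head < u.length :=
        (hc₀.head_lt_iff hpos).trans (hd₀.head_lt_iff hpos).symm
      have hbc := head_bounds_of_step hs
      have hbd := head_bounds_of_step hsd
      -- Both heads cross the same boundary in the same direction by one cell.
      have hhead : c'.head = d'.head := by omega
      by_cases hlt : c.head < u.length
      · refine exists_run_of_step (ih hd₀) (step_merge_left hs hlt (by simp [Cfg.merge, hq])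
          (by simp [Cfg.merge, hhead]) fun z hz => tape_of_step hsd ?_)
        omega
      · refine exists_run_of_step (ih hd₀) (step_merge_right hsd hlt (fun h => hlt (hcd.2 h))
          (by simp [Cfg.merge, hq]) (by simp [Cfg.merge, hhead])
          fun z hz => tape_of_step hs ?_)
        omega

theorem exists_acceptsIn_of_trace {M : OneTapeTM α Γ Q} {u u' v v' : List α}
    (hlen : u.length = u'.length) (hu : u ≠ []) {l : List Q} {c d : Cfg Γ Q}
    (hc : M.Trace u.length (u ++ v) l c) (hd : M.Trace u.length (u' ++ v') l d)
    (hcs : M.step c = none) (hds : M.step d = none)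
    (hca : c.state ∈ M.accept) (hda : d.state ∈ M.accept) :
    ∃ t, M.AcceptsIn (u ++ v') t := by
  have hpos : (0 : ℤ) < u.length := by exact_mod_cast List.length_pos_iff.2 hu
  obtain ⟨t, ht⟩ := exists_run_merge hlen hu hc hd
  have hcd := (hc.head_lt_iff hpos).trans (hd.head_lt_iff hpos).symm
  refine ⟨t, _, ht, ?_, ?_⟩
  · by_cases hlt : c.head < u.length
    · simpa [step, Cfg.merge, hlt] using hcs
    · simpa [step, Cfg.merge, hlt, mt hcd.2 hlt] using hds
  · simp only [Cfg.merge]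
    split_ifs <;> assumption

/-- Each step crosses at most one boundary, so the lengths of the crossing sequences add up to at
most the number of steps. -/
theorem exists_trace_sum_length_le {M : OneTapeTM α Γ Q} {w : List α} (S : Finset ℕ) {t : ℕ}
    {c : Cfg Γ Q} (h : M.run w t = some c) :
    ∃ l : ℕ → List Q, (∀ i : ℕ, M.Trace i w (l i) c) ∧ ∑ i ∈ S, (l i).length ≤ t := by
  induction t generalizing c with
  | zero =>
    obtain rfl : M.init w = c := by simpa [run] using h
    exact ⟨fun _ => [], fun _ => .init, by simp⟩
  | succ t ih =>
    obtain ⟨c₀, h₀, hs⟩ : ∃ c₀, M.run w t = some c₀ ∧ M.step c₀ = some c := by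
      simpa [run, Option.bind_eq_some_iff] using h
    obtain ⟨l, hl, hsum⟩ := ih h₀
    have hb := head_bounds_of_step hs
    classical
    refine ⟨fun i : ℕ => if (c₀.head < i ↔ c.head < i) then l i else c.state :: l i, fun i => ?_, ?_⟩
    · dsimp only
      split_ifs with hi
      · exact (hl i).stay hs hi
      · exact (hl i).cross hs hi
    · have hlen (i : ℕ) : (if (c₀.head < i ↔ c.head < i) then l i else c.state :: l i).length =
          (l i).length + if ¬(c₀.head < i ↔ c.head < i) then 1 else 0 := by
        split_ifs <;> simp_all
      simp only [hlen, Finset.sum_add_distrib, ← Finset.card_filter]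
      refine add_le_add hsum (Finset.card_le_one.2 fun i hi j hj => ?_)
      simp only [Finset.mem_filter] at hi hj
      have hi' := hi.2
      have hj' := hj.2
      omega

end OneTapeTM

/-! ### Padded palindromes. -/

/-- The palindrome that consists of `x`, then `m` letters `a`, then the reverse of `x`. -/
def paddedPalindrome {α : Type*} (a : α) (m : ℕ) (x : List α) : List α :=
  x ++ (List.replicate m a ++ x.reverse)

theorem paddedPalindrome_mem_palindromes {α : Type*} (a : α) (m : ℕ) (x : List α) :
    paddedPalindrome a m x ∈ palindromes α :=
  List.Palindrome.of_reverse_eq (by simp [paddedPalindrome])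

/-- Splicing inside the padding yields an accepted word with `x` in front and the reverse of `y` at
the end; being a palindrome, it forces `x = y`. -/
theorem OneTapeTM.eq_of_trace_paddedPalindrome {α Γ Q : Type*} {M : OneTapeTM α Γ Q}
    (hM : M.Recognizes (palindromes α)) {a : α} {m i : ℕ} {x y : List α}
    (hxy : x.length = y.length) (hx : x ≠ []) (hi : x.length ≤ i) (him : i ≤ x.length + m)
    {l : List Q} {c d : Cfg Γ Q} (hc : M.Trace i (paddedPalindrome a m x) l c)
    (hd : M.Trace i (paddedPalindrome a m y) l d)
    (hcs : M.step c = none) (hds : M.step d = none)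
    (hca : c.state ∈ M.accept) (hda : d.state ∈ M.accept) : x = y := by
  obtain ⟨j, rfl⟩ := Nat.exists_eq_add_of_le hi
  obtain ⟨k, rfl⟩ : ∃ k, m = j + k := Nat.exists_eq_add_of_le (by omega)
  have hsplit (z z' : List α) : z ++ (List.replicate (j + k) a ++ z'.reverse) =
      (z ++ List.replicate j a) ++ (List.replicate k a ++ z'.reverse) := by
    simp only [List.replicate_add, List.append_assoc]
  have hacc : ∃ t, M.AcceptsIn (x ++ (List.replicate (j + k) a ++ y.reverse)) t := by
    rw [hsplit]
    rw [paddedPalindrome, hsplit] at hc hd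
    have hlen : (x.length + j : ℕ) = (x ++ List.replicate j a).length := by simp
    rw [hlen] at hc hd
    exact exists_acceptsIn_of_trace (by simp [hxy]) (by simp [hx]) hc hd hcs hds hca hda
  have hpal := List.Palindrome.reverse_eq ((hM _).2 hacc)
  simp only [List.reverse_append, List.reverse_reverse, List.reverse_replicate,
    List.append_assoc] at hpal
  exact (List.append_inj_left hpal hxy.symm).symm

/-! ### Counting short crossing sequences. -/

/-- Padding with `none` bounds the number of sequences of length at most `s` by `(card Q + 1) ^ s`.
-/
theorem List.getElem?_fin_injOn {Q : Type*} (s : ℕ) :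
    Set.InjOn (fun (l : List Q) (j : Fin s) => l[(j : ℕ)]?) {l | l.length ≤ s} := by
  intro l hl l' hl' h
  refine List.ext_getElem? fun j => ?_
  by_cases hj : j < s
  · exact congrFun h ⟨j, hj⟩
  · simp only [Set.mem_ofPred_eq] at hl hl'
    rw [List.getElem?_eq_none (by omega), List.getElem?_eq_none (by omega)]

theorem six_mul_add_six_lt_two_pow {k : ℕ} (hk : 6 ≤ k) : 6 * k + 6 < 2 ^ k := by
  induction k, hk using Nat.le_induction with
  | base => norm_num
  | succ k hk ih => rw [pow_succ]; omega

/-- Some padded palindrome has only long crossing sequences at the boundaries in its padding. -/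
theorem OneTapeTM.exists_forall_lt_length_trace {α Γ Q : Type*} [Fintype Q]
    {M : OneTapeTM α Γ Q} (hM : M.Recognizes (palindromes α)) {a b : α} (hab : a ≠ b)
    {k m s : ℕ} (hk : 0 < k) (hcount : (m + 1) * (Fintype.card Q + 1) ^ s < 2 ^ k) :
    ∃ x : List α, x.length = k ∧ ∀ (i : ℕ) (l : List Q) (c : Cfg Γ Q), k ≤ i → i ≤ k + m →
      M.Trace i (paddedPalindrome a m x) l c → M.step c = none → c.state ∈ M.accept →
        s < l.length := by
  by_contra! hcon
  let word (f : Fin k → Bool) : List α := List.ofFn fun j => if f j then a else b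
  have hword : Function.Injective word := fun f g hfg => by
    funext j
    have := congrFun (List.ofFn_injective hfg) j
    revert this
    cases f j <;> cases g j <;> simp [hab, hab.symm]
  have hlen (f : Fin k → Bool) : (word f).length = k := by simp [word]
  choose i l c hki him htr hstep hacc hls using fun f => hcon (word f) (hlen f)
  -- Pigeonhole: if every word had a short sequence somewhere, its boundary and that sequence would
  -- determine the word.
  let code (f : Fin k → Bool) : Fin (m + 1) × (Fin s → Option Q) :=
    (⟨i f - k, by have := hki f; have := him f; omega⟩, fun j => (l f)[(j : ℕ)]?)
  have hcode : Function.Injective code := fun f g hfg => by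
    obtain ⟨h₁, h₂⟩ := Prod.mk.inj hfg
    have hi : i f = i g := by
      have := Fin.mk.inj h₁
      have := hki f
      have := hki g
      omega
    have hl : l f = l g := List.getElem?_fin_injOn s (hls f) (hls g) h₂
    refine hword (eq_of_trace_paddedPalindrome hM (by simp [hlen]) ?_ ?_ ?_ (htr f)
      (hi ▸ hl ▸ htr g) (hstep f) (hstep g) (hacc f) (hacc g))
    · exact List.ne_nil_of_length_pos (by rw [hlen]; exact hk)
    · rw [hlen]; exact hki f
    · rw [hlen]; exact him f
  have := Fintype.card_le_of_injective code hcode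
  simp at this
  omega

theorem mainTheorem6 {α Γ Q : Type*} [Nontrivial α] [Finite Γ] [Finite Q]
    (M : OneTapeTM α Γ Q) (hM : M.Recognizes (palindromes α)) :
    ∃ c : ℝ, 0 < c ∧ ∃ N : ℕ, ∀ n : ℕ, N ≤ n →
      ∃ w : List α, w.length = n ∧ w ∈ palindromes α ∧
        ∃ t : ℕ, M.AcceptsIn w t ∧ c * (n : ℝ) ^ 2 ≤ (t : ℝ) := by
  have := Fintype.ofFinite Q
  obtain ⟨a, b, hab⟩ := exists_pair_ne α
  set p := Fintype.card Q + 1 with hp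
  have hp0 : 0 < p := by omega
  -- The constant comes from `t ≥ (m + 1) * (s + 1) ≥ k ^ 2 / (2 * p)` and `k ≥ n / 4`; the bound 36
  -- gives `k ≥ 12`, hence `k - k / 2 ≥ 6`.
  refine ⟨1 / (32 * p), by positivity, 36, fun n hn => ?_⟩
  obtain ⟨k, m, hkm, hk, hkn, hmk, hmk'⟩ : ∃ k m, 2 * k + m = n ∧ 12 ≤ k ∧ n ≤ 4 * k ∧ k ≤ m ∧
      m ≤ k + 2 :=
    ⟨n / 3, n - 2 * (n / 3), by omega, by omega, by omega, by omega, by omega⟩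
  -- With this `s`, `p ^ s ≤ 2 ^ (k / 2)`, which leaves the factor `2 ^ (k - k / 2)` to beat `m +
  -- 1`.
  set s := k / (2 * p) with hs
  have hcount : (m + 1) * (Fintype.card Q + 1) ^ s < 2 ^ k := by
    have hps : p * s ≤ k / 2 := by
      rw [Nat.le_div_iff_mul_le two_pos]
      calc p * s * 2 = 2 * p * s := by ring
        _ ≤ k := Nat.mul_div_le k (2 * p)
    calc (m + 1) * (Fintype.card Q + 1) ^ s
        ≤ (m + 1) * (2 ^ p) ^ s := by
          gcongr
          exact Nat.lt_two_pow_self.le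
      _ = (m + 1) * 2 ^ (p * s) := by rw [pow_mul]
      _ ≤ (m + 1) * 2 ^ (k / 2) := by
          gcongr
          norm_num
      _ < 2 ^ (k - k / 2) * 2 ^ (k / 2) := by
          gcongr
          have := six_mul_add_six_lt_two_pow (k := k - k / 2) (by omega)
          omega
      _ = 2 ^ k := by rw [← pow_add]; congr 1; omega
  obtain ⟨x, hx, hlong⟩ := OneTapeTM.exists_forall_lt_length_trace hM hab (by omega) hcount
  have hpal := paddedPalindrome_mem_palindromes a m x
  obtain ⟨t, ht⟩ := (hM _).1 hpal
  refine ⟨_, by simp [paddedPalindrome, hx]; omega, hpal, t, ht, ?_⟩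
  obtain ⟨c, hrun, hstep, hacc⟩ := ht
  obtain ⟨l, hl, hsum⟩ := OneTapeTM.exists_trace_sum_length_le (Finset.Icc k (k + m)) hrun
  have hle : (m + 1) * (s + 1) ≤ t := by
    refine le_trans ?_ hsum
    have := Finset.card_nsmul_le_sum (Finset.Icc k (k + m)) (fun i => (l i).length) (s + 1)
      fun i hi => by
        obtain ⟨h₁, h₂⟩ := Finset.mem_Icc.1 hi
        exact hlong i (l i) c h₁ h₂ (hl i) hstep hacc
    rw [Nat.card_Icc, smul_eq_mul] at this
    rwa [show k + m + 1 - k = m + 1 by omega] at this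
  have hks : k ≤ 2 * p * (s + 1) := (Nat.lt_mul_div_succ k (by omega)).le
  have hnat : n ^ 2 ≤ 32 * p * t := by
    calc n ^ 2 ≤ (4 * k) ^ 2 := by gcongr
      _ = 16 * (k * k) := by ring
      _ ≤ 16 * ((m + 1) * (2 * p * (s + 1))) := by
          gcongr
          omega
      _ = 32 * p * ((m + 1) * (s + 1)) := by ring
      _ ≤ 32 * p * t := by gcongr
  rw [one_div_mul_eq_div, div_le_iff₀ (by positivity)]
  calc (n : ℝ) ^ 2 ≤ 32 * p * t := by exact_mod_cast hnat
    _ = t * (32 * p) := by ring
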